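/- Let $\mathbb{F}=\mathbb{C}(q)$, let $[n]=\dfrac{q^n-q^{-n}}{q-q^{-1}}\in\mathbb{F}$ for $n\ge 0$, and let $d=[2]=q+q^{-1}$. Let $\mathrm{TL}$ be the generic Temperley--Lieb category: its objects are the non-negative integers, and $\mathrm{Hom}(m,n)$ is the $\mathbb{F}$-linear span of the planar (non-crossing) diagrams joining $m$ points on the bottom edge and $n$ points on the top edge of a square in pairs by disjoint arcs, where a closed loop may be removed at the cost of a factor $d$ (so the diagrams without closed loops form a basis). Composition $g\circ f$ is stacking $g$ on top of $f$, the tensor product $f\otimes g$ is juxtaposition with $f$ on the left, and $\mathrm{id}_n$ is the diagram of $n$ through-strings. For $f\in\mathrm{Hom}(n,n)$, the trace $\mathrm{tr}(f)\in\mathrm{Hom}(0,0)=\mathbb{F}$ is obtained by joining the corresponding points on the top and bottom edges by $n$ disjoint arcs around the outside of $f$ (extended linearly), and for $n\ge 1$ the one-strand right trace $\mathrm{tr}_1(f)\in\mathrm{Hom}(n-1,n-1)$ is obtained by joining only the rightmost top point to the rightmost bottom point by an arc around the right-hand side of $f$. The Jones--Wenzl idempotents $p_n\in\mathrm{Hom}(n,n)$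 are defined by $p_0=\mathrm{id}_0$, $p_1=\mathrm{id}_1$ and, for $n\ge 1$, $$p_{n+1}=(p_n\otimes \mathrm{id}_1)-\frac{[n]}{[n+1]}\,(p_n\otimes \mathrm{id}_1)\circ U_n\circ(p_n\otimes \mathrm{id}_1),$$ where $U_n\in\mathrm{Hom}(n+1,n+1)$ consists of $n-1$ through-strings followed on the right by a cup above a cap. Then $$\mathrm{tr}(p_n)=[n+1]\qquad\text{for all } n\ge 0,$$ and moreover $$\mathrm{tr}_1(p_n)=\frac{[n+1]}{[n]}\,p_{n-1}\qquad\text{for all } n\ge 1.$$ -/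

import Mathlib

open scoped BigOperators

noncomputable section

namespace TemperleyLieb

/-! ### The ground field and quantum integers -/

/-- The ground field `ℂ(q)`. -/
abbrev GroundField : Type := RatFunc ℂ

/-- The formal parameter `q`. -/
def q : GroundField := RatFunc.X

/-- The quantum integer `[n] = (q ^ n - q ^ (-n)) / (q - q ^ (-1))`. -/
def quantumInt (n : ℕ) : GroundField := (q ^ n - q⁻¹ ^ n) / (q - q⁻¹)

/-- The loop variable `d = [2]`. -/
def loopVar : GroundField := quantumInt 2

/-! ### Planar diagrams without closed loops -/

/-- The position of a boundary point when one runs once around the boundary of the square: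
first the `m` points of the bottom edge from left to right,
then the `n` points of the top edge from right to left. -/
def pos {m n : ℕ} : Fin m ⊕ Fin n → ℕ
  | Sum.inl i => i
  | Sum.inr j => m + (n - 1 - j)

/-- A loopless simple Temperley-Lieb diagram from `m` points (on the bottom edge) to `n` points
(on the top edge), up to planar isotopy: every distinguished point is joined by an arc to exactly
one other distinguished point, and no two arcs cross. -/
@[ext]
structure Diagram (m n : ℕ) where
  /-- the other end of the arc at a given point -/
  partner : Fin m ⊕ Fin n → Fin m ⊕ Fin n
  partner_partner : ∀ x, partner (partner x) = x
  partner_ne : ∀ x, partner x ≠ x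
  planar : ∀ x y, ¬ (pos x < pos y ∧ pos y < pos (partner x) ∧ pos (partner x) < pos (partner y))

namespace Diagram

variable {m n k m' n' : ℕ}

/-! ### Helper facts on involutions -/

theorem eqvGen_iterate {X : Type*} (σ τ : X → X) (x : X) (i : ℕ) :
    Relation.EqvGen (fun a b => σ a = b ∨ τ a = b) x ((fun a => τ (σ a))^[i] x) := by
  induction i with
  | zero => exact .refl _
  | succ i ih =>
    rw [Function.iterate_succ_apply']
    exact .trans _ _ _ ih (.trans _ _ _ (.rel _ _ (Or.inl rfl)) (.rel _ _ (Or.inr rfl)))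

/-- An orbit of two involutions that contains an end contains exactly two ends. -/
theorem existsUnique_end {X : Type*} [Finite X] (σ τ : X → X) (hσ : ∀ x, σ (σ x) = x)
    (hτ : ∀ x, τ (τ x) = x) (hne : ∀ x, ¬ (σ x = x ∧ τ x = x)) (x : X) (hx : τ x = x) :
    ∃! y, y ≠ x ∧ (σ y = y ∨ τ y = y) ∧ Relation.EqvGen (fun a b => σ a = b ∨ τ a = b) x y := by
  set c : X → X := fun a => τ (σ a) with hc
  have hinj : Function.Injective c := fun a b h => by
    have h1 : σ a = σ b := by
      have := congrArg τ h
      simpa [hc, hτ] using this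
    have := congrArg σ h1
    simpa [hσ] using this
  set N := Function.minimalPeriod c x with hN
  have hper : x ∈ Function.periodicPts c := hinj.mem_periodicPts x
  have hNpos : 0 < N := Function.minimalPeriod_pos_of_mem_periodicPts hper
  have hcN : c^[N] x = x := Function.iterate_minimalPeriod
  -- two powers adding up to a multiple of the period are exchanged by `τ`
  have key : ∀ i j, c^[i + j] x = x → τ (c^[i] x) = c^[j] x := by
    intro i
    induction i with
    | zero => intro j h; simp only [Nat.zero_add] at h; simp [hx, h]
    | succ i ih =>
      intro j h
      have h' : c^[i + (j + 1)] x = x := by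
        rw [show i + (j + 1) = i + 1 + j by omega]; exact h
      have h2 := ih (j + 1) h'
      rw [Function.iterate_succ_apply'] at h2 ⊢
      have h3 : c^[i] x = σ (c^[j] x) := by
        have := congrArg τ h2
        simpa [hc, hτ] using this
      simp only [hc] at h3 ⊢
      rw [h3, hσ, hτ]
  have hmod : ∀ i j, c^[i] x = c^[j] x ↔ i % N = j % N := fun i j => by
    rw [← Function.iterate_mod_minimalPeriod_eq (f := c) (x := x) (n := i),
      ← Function.iterate_mod_minimalPeriod_eq (f := c) (x := x) (n := j)]
    exact Function.iterate_eq_iterate_iff_of_lt_minimalPeriod (Nat.mod_lt _ hNpos)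
      (Nat.mod_lt _ hNpos)
  have hτi : ∀ i, i < N → τ (c^[i] x) = c^[N - i] x := fun i hi =>
    key i (N - i) (by rw [show i + (N - i) = N by omega]; exact hcN)
  have hσi : ∀ i, i < N → σ (c^[i] x) = c^[N - (i + 1)] x := fun i hi => by
    have h1 := key (i + 1) (N - (i + 1)) (by
      rw [show i + 1 + (N - (i + 1)) = N by omega]; exact hcN)
    rw [Function.iterate_succ_apply'] at h1
    simpa [hc, hτ] using h1
  have hrep : ∀ i, ∃ j < N, c^[i] x = c^[j] x := fun i =>
    ⟨i % N, Nat.mod_lt _ hNpos, (hmod _ _).2 (Nat.mod_mod _ _).symm⟩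
  have horb : ∀ y, Relation.EqvGen (fun a b => σ a = b ∨ τ a = b) x y → ∃ j < N, y = c^[j] x := by
    have hst : ∀ a, (∃ j < N, a = c^[j] x) →
        (∃ j < N, σ a = c^[j] x) ∧ (∃ j < N, τ a = c^[j] x) := by
      rintro a ⟨j, hj, rfl⟩
      exact ⟨by rw [hσi j hj]; exact hrep _, by rw [hτi j hj]; exact hrep _⟩
    have haux : ∀ a b, Relation.EqvGen (fun a b => σ a = b ∨ τ a = b) a b →
        ((∃ j < N, a = c^[j] x) ↔ (∃ j < N, b = c^[j] x)) := by
      intro a b h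
      induction h with
      | rel a b h =>
        rcases h with rfl | rfl
        · exact ⟨fun h => (hst _ h).1, fun h => by simpa [hσ] using (hst _ h).1⟩
        · exact ⟨fun h => (hst _ h).2, fun h => by simpa [hτ] using (hst _ h).2⟩
      | refl a => exact Iff.rfl
      | symm a b _ ih => exact ih.symm
      | trans a b c _ _ ih1 ih2 => exact ih1.trans ih2
    exact fun y h => (haux x y h).1 ⟨0, hNpos, rfl⟩
  have hend : ∀ i, 0 < i → i < N →
      ((σ (c^[i] x) = c^[i] x ∨ τ (c^[i] x) = c^[i] x) ↔ i = N / 2) := by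
    intro i hi0 hi
    rw [hσi i hi, hτi i hi, hmod, hmod, Nat.mod_eq_of_lt (show N - (i + 1) < N by omega),
      Nat.mod_eq_of_lt (show N - i < N by omega), Nat.mod_eq_of_lt hi]
    omega
  have hN1 : N ≠ 1 := by
    intro h1
    rw [h1] at hcN
    simp only [Function.iterate_one, hc] at hcN
    have : σ x = x := by
      have := congrArg τ hcN
      rwa [hτ, hx] at this
    exact hne x ⟨this, hx⟩
  have hx0 : ∀ i, i < N → c^[i] x = x → i = 0 := by
    intro i hi h
    have := (hmod i 0).1 h
    rwa [Nat.mod_eq_of_lt hi, Nat.zero_mod] at this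
  refine ⟨c^[N / 2] x, ⟨?_, ?_, eqvGen_iterate σ τ x _⟩, ?_⟩
  · intro h
    have := hx0 _ (by omega) h
    omega
  · exact (hend _ (by omega) (by omega)).2 rfl
  · rintro y ⟨hy1, hy2, hy3⟩
    obtain ⟨j, hj, rfl⟩ := horb y hy3
    have hj0 : 0 < j := by
      rcases Nat.eq_zero_or_pos j with rfl | h
      · exact absurd rfl hy1
      · exact h
    rw [(hend j hj0 hj).1 hy2]

/-! ### Helper facts on planarity -/

theorem pos_injective : Function.Injective (pos : Fin m ⊕ Fin n → ℕ) := by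
  rintro (i | i) (j | j) h <;> simp only [pos] at h
  · exact congrArg _ (Fin.ext h)
  · omega
  · omega
  · exact congrArg _ (Fin.ext (by omega))

/-- Parity indicator of the order of two numbers. -/
def chi (a b : ℕ) : ZMod 2 := if a < b then 1 else 0

theorem sum_invariant {X : Type*} [Fintype X] (p : X → X) (h : ∀ x, p (p x) = x)
    (hne : ∀ x, p x ≠ x) (α : X → ZMod 2) (hα : ∀ x, α (p x) = α x) : ∑ x, α x = 0 :=
  Finset.sum_involution (fun a _ => p a)
    (fun a _ => by rw [hα]; exact CharTwo.add_self_eq_zero _) (fun a _ _ => hne a)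
    (fun _ _ => Finset.mem_univ _) (fun a _ => h a)

theorem chi_add {a a' b b' : ℕ} (e1 : a ≠ b) (e2 : a' ≠ b) (e3 : a ≠ b') (e4 : a' ≠ b')
    (p1 : ¬ (a < b ∧ b < a' ∧ a' < b')) (p2 : ¬ (a < b' ∧ b' < a' ∧ a' < b))
    (p3 : ¬ (a' < b ∧ b < a ∧ a < b')) (p4 : ¬ (a' < b' ∧ b' < a ∧ a < b))
    (p5 : ¬ (b < a ∧ a < b' ∧ b' < a')) (p6 : ¬ (b < a' ∧ a' < b' ∧ b' < a))
    (p7 : ¬ (b' < a ∧ a < b ∧ b < a')) (p8 : ¬ (b' < a' ∧ a' < b ∧ b < a)) :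
    chi a b + chi a' b + (chi a b' + chi a' b') = 0 := by
  have h0 : (1 : ZMod 2) + 1 = 0 := by decide
  rcases lt_or_gt_of_ne e1 with h1 | h1 <;> rcases lt_or_gt_of_ne e2 with h2 | h2 <;>
    rcases lt_or_gt_of_ne e3 with h3 | h3 <;> rcases lt_or_gt_of_ne e4 with h4 | h4 <;>
    simp only [chi, h1, h2, h3, h4, not_lt_of_gt, if_true, if_false, h0, add_zero, zero_add] <;>
    exfalso <;> simp only [h1, h2, h3, h4, true_and, and_true, not_true] at *

/-- Two disjoint families of arcs of a planar diagram cross an even number of times. -/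
theorem sum_chi (D : Diagram m n) (α β : Fin m ⊕ Fin n → ZMod 2)
    (hα : ∀ x, α (D.partner x) = α x) (hβ : ∀ x, β (D.partner x) = β x)
    (hαβ : ∀ x, α x * β x = 0) :
    ∑ x, ∑ y, α x * β y * chi (pos x) (pos y) = 0 := by
  refine Finset.sum_involution (fun a _ => D.partner a) ?_ (fun a _ _ => D.partner_ne a)
    (fun _ _ => Finset.mem_univ _) (fun a _ => D.partner_partner a)
  intro x _
  rw [← Finset.sum_add_distrib]
  refine Finset.sum_involution (fun a _ => D.partner a) ?_ (fun a _ _ => D.partner_ne a)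
    (fun _ _ => Finset.mem_univ _) (fun a _ => D.partner_partner a)
  intro y _
  rw [hα, hβ]
  by_cases hxy : y = x
  · subst hxy; rw [hαβ]; ring
  by_cases hxy' : y = D.partner x
  · subst hxy'; rw [hβ, hαβ]; ring
  have e1 : pos x ≠ pos y := fun h => hxy (pos_injective h).symm
  have e2 : pos (D.partner x) ≠ pos y := fun h => hxy' (pos_injective h).symm
  have e3 : pos x ≠ pos (D.partner y) := fun h => hxy' (by
    rw [pos_injective h, D.partner_partner])
  have e4 : pos (D.partner x) ≠ pos (D.partner y) := fun h => hxy (by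
    have := congrArg D.partner (pos_injective h)
    rw [D.partner_partner, D.partner_partner] at this
    exact this.symm)
  have p1 := D.planar x y
  have p2 := D.planar x (D.partner y)
  have p3 := D.planar (D.partner x) y
  have p4 := D.planar (D.partner x) (D.partner y)
  have p5 := D.planar y x
  have p6 := D.planar y (D.partner x)
  have p7 := D.planar (D.partner y) x
  have p8 := D.planar (D.partner y) (D.partner x)
  simp only [D.partner_partner] at p1 p2 p3 p4 p5 p6 p7 p8
  have hs := chi_add e1 e2 e3 e4 p1 p2 p3 p4 p5 p6 p7 p8
  linear_combination (α x * β y) * hs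

/-! ### Identity, cup and cap -/

/-- The identity diagram: `n` vertical through-strings. -/
def one (n : ℕ) : Diagram n n where
  partner := Sum.swap
  partner_partner := Sum.swap_swap
  partner_ne := by rintro (i | i) <;> simp
  planar := by
    rintro (i | i) (j | j) <;> simp only [pos, Sum.swap_inl, Sum.swap_inr] <;> omega

/-- The diagram from `0` to `2` points which is a single cup. -/
def cup : Diagram 0 2 where
  partner := Sum.map id Fin.rev
  partner_partner := by rintro (i | i) <;> simp
  partner_ne := by
    rintro (i | i)
    · exact i.elim0
    · fin_cases i <;> decide
  planar := by
    rintro (i | i) (j | j)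
    · exact i.elim0
    · exact i.elim0
    · exact j.elim0
    · simp only [pos, Sum.map_inr, Fin.val_rev]; omega

/-- The diagram from `2` to `0` points which is a single cap. -/
def cap : Diagram 2 0 where
  partner := Sum.map Fin.rev id
  partner_partner := by rintro (i | i) <;> simp
  partner_ne := by
    rintro (i | i)
    · fin_cases i <;> decide
    · exact i.elim0
  planar := by
    rintro (i | i) (j | j)
    · simp only [pos, Sum.map_inl, Fin.val_rev]; omega
    · exact j.elim0
    · exact i.elim0
    · exact i.elim0

/-! ### Juxtaposition -/

/-- The boundary points of a juxtaposition: those of the left diagram and those of the right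
diagram. -/
def split (m n m' n' : ℕ) :
    Fin (m + m') ⊕ Fin (n + n') ≃ (Fin m ⊕ Fin n) ⊕ (Fin m' ⊕ Fin n') :=
  (Equiv.sumCongr finSumFinEquiv.symm finSumFinEquiv.symm).trans
    (Equiv.sumSumSumComm (Fin m) (Fin m') (Fin n) (Fin n'))

theorem pos_split_symm_inl (x : Fin m ⊕ Fin n) :
    pos ((split m n m' n').symm (Sum.inl x)) =
      if pos x < m then pos x else pos x + m' + n' := by
  rcases x with i | i
  · simp [split, pos]
  · simp [split, pos]; omega

theorem pos_split_symm_inr (x : Fin m' ⊕ Fin n') :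
    pos ((split m n m' n').symm (Sum.inr x)) = m + pos x := by
  rcases x with i | i
  · simp [split, pos]
  · simp [split, pos]; omega

theorem pos_lt (x : Fin m ⊕ Fin n) : pos x < m + n := by
  rcases x with i | i <;> simp only [pos] <;> omega

/-- The tensor product of diagrams: `D` is placed to the left of `E`. -/
def tensor (D : Diagram m n) (E : Diagram m' n') : Diagram (m + m') (n + n') where
  partner x := (split m n m' n').symm (Sum.map D.partner E.partner (split m n m' n' x))
  partner_partner x := by
    rw [Equiv.apply_symm_apply, Equiv.symm_apply_eq]
    rcases split m n m' n' x with y | y <;> simp [D.partner_partner, E.partner_partner]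
  partner_ne x := by
    rw [Ne, Equiv.symm_apply_eq]
    rcases split m n m' n' x with y | y <;> simp [D.partner_ne, E.partner_ne]
  planar x y := by
    obtain ⟨x, rfl⟩ := (split m n m' n').symm.surjective x
    obtain ⟨y, rfl⟩ := (split m n m' n').symm.surjective y
    simp only [Equiv.apply_symm_apply]
    rcases x with x | x <;> rcases y with y | y <;>
      simp only [Sum.map_inl, Sum.map_inr, pos_split_symm_inl, pos_split_symm_inr]
    · have := D.planar x y
      split_ifs <;> omega
    · have := pos_lt y
      have := pos_lt (E.partner y)
      split_ifs <;> omega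
    · have := pos_lt x
      have := pos_lt (E.partner x)
      split_ifs <;> omega
    · have := E.planar x y
      omega

/-! ### Vertical stacking

`E` is stacked on top of `D`. The points of the stacked picture are the `m` bottom points, the `n`
middle points (where the top edge of `D` meets the bottom edge of `E`) and the `k` top points. -/

/-- The arcs of the lower diagram `D` in the stacked picture (top points are fixed). -/
def lowerArc (k : ℕ) (D : Diagram m n) : Fin m ⊕ Fin n ⊕ Fin k → Fin m ⊕ Fin n ⊕ Fin k
  | Sum.inl i => Sum.map id Sum.inl (D.partner (Sum.inl i))
  | Sum.inr (Sum.inl j) => Sum.map id Sum.inl (D.partner (Sum.inr j))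
  | Sum.inr (Sum.inr l) => Sum.inr (Sum.inr l)

/-- The arcs of the upper diagram `E` in the stacked picture (bottom points are fixed). -/
def upperArc (m : ℕ) (E : Diagram n k) : Fin m ⊕ Fin n ⊕ Fin k → Fin m ⊕ Fin n ⊕ Fin k
  | Sum.inl i => Sum.inl i
  | Sum.inr y => Sum.inr (E.partner y)

/-- Two points of the stacked picture are related when they lie on the same curve. -/
def stack (E : Diagram n k) (D : Diagram m n) : Setoid (Fin m ⊕ Fin n ⊕ Fin k) :=
  Relation.EqvGen.setoid fun a b => lowerArc k D a = b ∨ upperArc m E a = b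

/-- The boundary points among the points of the stacked picture. -/
def outer : Fin m ⊕ Fin k → Fin m ⊕ Fin n ⊕ Fin k := Sum.map id Sum.inr

/-- The number of closed loops created by stacking `E` on top of `D`, i.e. of curves which do not
reach the boundary. -/
def loops (E : Diagram n k) (D : Diagram m n) : ℕ :=
  Nat.card {c : Quotient (stack E D) //
    ∀ x : Fin m ⊕ Fin k, (Quotient.mk (stack E D) (outer x)) ≠ c}

theorem lowerArc_map (D : Diagram m n) (x : Fin m ⊕ Fin n) :
    lowerArc k D (Sum.map id Sum.inl x) = Sum.map id Sum.inl (D.partner x) := by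
  rcases x with i | i <;> rfl

theorem lowerArc_lowerArc (D : Diagram m n) (x : Fin m ⊕ Fin n ⊕ Fin k) :
    lowerArc k D (lowerArc k D x) = x := by
  rcases x with i | i | i
  · change lowerArc k D (Sum.map id Sum.inl (D.partner (Sum.inl i))) = _
    rw [lowerArc_map, D.partner_partner]; rfl
  · change lowerArc k D (Sum.map id Sum.inl (D.partner (Sum.inr i))) = _
    rw [lowerArc_map, D.partner_partner]; rfl
  · rfl

theorem upperArc_upperArc (E : Diagram n k) (x : Fin m ⊕ Fin n ⊕ Fin k) :
    upperArc m E (upperArc m E x) = x := by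
  rcases x with i | i
  · rfl
  · simp [upperArc, E.partner_partner]

theorem lowerArc_eq_self_iff (D : Diagram m n) (x : Fin m ⊕ Fin n ⊕ Fin k) :
    lowerArc k D x = x ↔ ∃ l, x = Sum.inr (Sum.inr l) := by
  have hinj : Function.Injective (Sum.map id Sum.inl : Fin m ⊕ Fin n → Fin m ⊕ Fin n ⊕ Fin k) :=
    Function.Injective.sumMap Function.injective_id Sum.inl_injective
  rcases x with i | i | i
  · refine ⟨fun h => ?_, by simp⟩
    exact absurd (hinj (h.trans (by rfl : _ = Sum.map id Sum.inl (Sum.inl i)))) (D.partner_ne _)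
  · refine ⟨fun h => ?_, by simp⟩
    exact absurd (hinj (h.trans (by rfl : _ = Sum.map id Sum.inl (Sum.inr i)))) (D.partner_ne _)
  · simp [lowerArc]

theorem upperArc_eq_self_iff (E : Diagram n k) (x : Fin m ⊕ Fin n ⊕ Fin k) :
    upperArc m E x = x ↔ ∃ i, x = Sum.inl i := by
  rcases x with i | i
  · simp [upperArc]
  · simp [upperArc, E.partner_ne]

theorem end_iff (E : Diagram n k) (D : Diagram m n) (x : Fin m ⊕ Fin n ⊕ Fin k) :
    (lowerArc k D x = x ∨ upperArc m E x = x) ↔ ∃ y : Fin m ⊕ Fin k, outer y = x := by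
  rw [lowerArc_eq_self_iff, upperArc_eq_self_iff]
  constructor
  · rintro (⟨l, rfl⟩ | ⟨i, rfl⟩)
    · exact ⟨Sum.inr l, rfl⟩
    · exact ⟨Sum.inl i, rfl⟩
  · rintro ⟨i | l, rfl⟩
    · exact Or.inr ⟨i, rfl⟩
    · exact Or.inl ⟨l, rfl⟩

theorem outer_injective : Function.Injective (outer : Fin m ⊕ Fin k → Fin m ⊕ Fin n ⊕ Fin k) :=
  Function.Injective.sumMap Function.injective_id Sum.inr_injective

/-- The curve through a boundary point of the stacked picture has exactly one other end. -/
theorem existsUnique_stack (E : Diagram n k) (D : Diagram m n) (x : Fin m ⊕ Fin k) :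
    ∃! y : Fin m ⊕ Fin k, y ≠ x ∧ stack E D (outer x) (outer y) := by
  have hne : ∀ z, ¬ (lowerArc k D z = z ∧ upperArc m E z = z) := by
    intro z
    rw [lowerArc_eq_self_iff, upperArc_eq_self_iff]
    rintro ⟨⟨l, rfl⟩, ⟨i, h⟩⟩
    simp at h
  have main : ∃! z, z ≠ (outer x : Fin m ⊕ Fin n ⊕ Fin k) ∧
      (lowerArc k D z = z ∨ upperArc m E z = z) ∧ stack E D (outer x) z := by
    rcases (end_iff E D (outer x)).2 ⟨x, rfl⟩ with h | h
    · have := existsUnique_end (upperArc m E) (lowerArc k D) (upperArc_upperArc E)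
        (lowerArc_lowerArc D) (fun z hz => hne z hz.symm) _ h
      have hst : ∀ a b, stack E D a b ↔ Relation.EqvGen
          (fun a b => upperArc m E a = b ∨ lowerArc k D a = b) a b := by
        intro a b
        have : (fun a b => upperArc m E a = b ∨ lowerArc k D a = b) =
            fun a b => lowerArc k D a = b ∨ upperArc m E a = b := by
          funext a b; exact propext or_comm
        rw [this]; rfl
      simp only [hst]
      obtain ⟨z, ⟨h1, h2, h3⟩, hu⟩ := this
      exact ⟨z, ⟨h1, h2.symm, h3⟩, fun w hw => hu w ⟨hw.1, hw.2.1.symm, hw.2.2⟩⟩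
    · exact existsUnique_end (lowerArc k D) (upperArc m E) (lowerArc_lowerArc D)
        (upperArc_upperArc E) hne _ h
  obtain ⟨z, ⟨h1, h2, h3⟩, hu⟩ := main
  obtain ⟨y, rfl⟩ := (end_iff E D z).1 h2
  refine ⟨y, ⟨fun h => h1 (by rw [h]), h3⟩, fun y' ⟨h4, h5⟩ => ?_⟩
  exact outer_injective (hu (outer y') ⟨fun h => h4 (outer_injective h),
    (end_iff E D _).2 ⟨y', rfl⟩, h5⟩)

/-- The other end of the curve through a boundary point of the stacked picture. -/
def compPartner (E : Diagram n k) (D : Diagram m n) (x : Fin m ⊕ Fin k) : Fin m ⊕ Fin k :=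
  Classical.choose (existsUnique_stack E D x)

theorem compPartner_ne (E : Diagram n k) (D : Diagram m n) (x : Fin m ⊕ Fin k) :
    compPartner E D x ≠ x :=
  (Classical.choose_spec (existsUnique_stack E D x)).1.1

theorem stack_compPartner (E : Diagram n k) (D : Diagram m n) (x : Fin m ⊕ Fin k) :
    stack E D (outer x) (outer (compPartner E D x)) :=
  (Classical.choose_spec (existsUnique_stack E D x)).1.2

theorem eq_compPartner (E : Diagram n k) (D : Diagram m n) (x y : Fin m ⊕ Fin k)
    (h1 : y ≠ x) (h2 : stack E D (outer x) (outer y)) : y = compPartner E D x :=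
  (Classical.choose_spec (existsUnique_stack E D x)).2 y ⟨h1, h2⟩

theorem sum_chi_stack (E : Diagram n k) (D : Diagram m n)
    (α β : Fin m ⊕ Fin n ⊕ Fin k → ZMod 2)
    (hα : ∀ x y, stack E D x y → α x = α y) (hβ : ∀ x y, stack E D x y → β x = β y)
    (hαβ : ∀ x, α x * β x = 0) :
    ∑ x : Fin m ⊕ Fin k, ∑ y : Fin m ⊕ Fin k,
      α (outer x) * β (outer y) * chi (pos x) (pos y) = 0 := by
  have hl : ∀ γ : Fin m ⊕ Fin n ⊕ Fin k → ZMod 2, (∀ x y, stack E D x y → γ x = γ y) →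
      ∀ x : Fin m ⊕ Fin n, γ (Sum.map id Sum.inl (D.partner x)) = γ (Sum.map id Sum.inl x) := by
    intro γ hγ x
    refine (hγ _ _ (.rel _ _ (Or.inl ?_))).symm
    exact lowerArc_map D x
  have hu : ∀ γ : Fin m ⊕ Fin n ⊕ Fin k → ZMod 2, (∀ x y, stack E D x y → γ x = γ y) →
      ∀ x : Fin n ⊕ Fin k, γ (Sum.inr (E.partner x)) = γ (Sum.inr x) := by
    intro γ hγ x
    exact (hγ (Sum.inr x) (Sum.inr (E.partner x)) (.rel _ _ (Or.inr rfl))).symm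
  have a1 := sum_invariant D.partner D.partner_partner D.partner_ne
    (fun x => α (Sum.map id Sum.inl x)) (hl α hα)
  have a2 := sum_invariant E.partner E.partner_partner E.partner_ne
    (fun x => α (Sum.inr x)) (hu α hα)
  have b1 := sum_invariant D.partner D.partner_partner D.partner_ne
    (fun x => β (Sum.map id Sum.inl x)) (hl β hβ)
  have b2 := sum_invariant E.partner E.partner_partner E.partner_ne
    (fun x => β (Sum.inr x)) (hu β hβ)
  have s1 := sum_chi D (fun x => α (Sum.map id Sum.inl x))
    (fun x => β (Sum.map id Sum.inl x)) (hl α hα) (hl β hβ) (fun x => hαβ _)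
  have s2 := sum_chi E (fun x => α (Sum.inr x)) (fun x => β (Sum.inr x)) (hu α hα) (hu β hβ) (fun x => hαβ _)
  have c1 : ∀ (r s : ℕ) (i : Fin r) (j : Fin s), chi (i : ℕ) (r + (s - 1 - (j : ℕ))) = 1 :=
    fun r s i j => by unfold chi; rw [if_pos (by omega)]
  have c2 : ∀ (r s : ℕ) (i : Fin r) (j : Fin s), chi (r + (s - 1 - (j : ℕ))) (i : ℕ) = 0 :=
    fun r s i j => by unfold chi; rw [if_neg (by omega)]
  have c3 : ∀ (r s : ℕ) (i j : Fin s),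
      chi (r + (s - 1 - (i : ℕ))) (r + (s - 1 - (j : ℕ))) = chi (j : ℕ) (i : ℕ) :=
    fun r s i j => by
      unfold chi
      by_cases h : (j : ℕ) < i
      · rw [if_pos h, if_pos (by omega)]
      · rw [if_neg h, if_neg (by omega)]
  simp only [Fintype.sum_sum_type, Sum.map_inl, Sum.map_inr, id, pos, c1, c2, c3, outer, mul_one,
    mul_zero, Finset.sum_const_zero, add_zero, Finset.sum_add_distrib,
    ← Finset.mul_sum, ← Finset.sum_mul] at a1 a2 b1 b2 s1 s2 ⊢
  have mid : ∑ i : Fin n, ∑ j : Fin n, α (Sum.inr (Sum.inl i)) * β (Sum.inr (Sum.inl j)) *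
        chi (j : ℕ) (i : ℕ)
      + ∑ i : Fin n, ∑ j : Fin n, α (Sum.inr (Sum.inl i)) * β (Sum.inr (Sum.inl j)) *
        chi (i : ℕ) (j : ℕ)
      = (∑ i : Fin n, α (Sum.inr (Sum.inl i))) * ∑ j : Fin n, β (Sum.inr (Sum.inl j)) := by
    rw [Finset.sum_mul_sum, ← Finset.sum_add_distrib]
    refine Finset.sum_congr rfl fun i _ => ?_
    rw [← Finset.sum_add_distrib]
    refine Finset.sum_congr rfl fun j _ => ?_
    by_cases hij : i = j
    · subst hij; rw [hαβ]; ring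
    · have : chi (j : ℕ) (i : ℕ) + chi (i : ℕ) (j : ℕ) = 1 := by
        have : (i : ℕ) ≠ j := fun h => hij (Fin.ext h)
        unfold chi
        split_ifs <;> first | (exfalso; omega) | decide
      linear_combination (α (Sum.inr (Sum.inl i)) * β (Sum.inr (Sum.inl j))) * this
  have ha : ∑ i : Fin m, α (Sum.inl i) = ∑ i : Fin n, α (Sum.inr (Sum.inl i)) := by
    rwa [CharTwo.add_eq_zero] at a1
  have hb : ∑ i : Fin k, β (Sum.inr (Sum.inr i)) = ∑ i : Fin n, β (Sum.inr (Sum.inl i)) := by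
    rw [CharTwo.add_eq_zero] at b2
    exact b2.symm
  rw [ha] at s1 ⊢
  rw [hb] at s2 ⊢
  have two : (2 : ZMod 2) = 0 := by decide
  linear_combination s1 + s2 - mid - (∑ i : Fin n, α (Sum.inr (Sum.inl i))) *
    (∑ i : Fin n, β (Sum.inr (Sum.inl i))) * two

theorem comp_planar (E : Diagram n k) (D : Diagram m n) (x y : Fin m ⊕ Fin k) :
    ¬ (pos x < pos y ∧ pos y < pos (compPartner E D x) ∧
      pos (compPartner E D x) < pos (compPartner E D y)) := by
  classical
  rintro ⟨h1, h2, h3⟩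
  have hyx : y ≠ x := fun h => by rw [h] at h1; omega
  have hyx' : y ≠ compPartner E D x := fun h => by rw [← h] at h2; omega
  have hdis : ¬ stack E D (outer x) (outer y) := fun h => hyx' (eq_compPartner E D x y hyx h)
  have hsum := sum_chi_stack E D
    (fun z => if stack E D (outer x) z then 1 else 0)
    (fun z => if stack E D (outer y) z then 1 else 0)
    (fun a b h => by
      have : stack E D (outer x) a ↔ stack E D (outer x) b :=
        ⟨fun h' => (stack E D).trans h' h, fun h' => (stack E D).trans h' ((stack E D).symm h)⟩
      simp only [this])
    (fun a b h => by
      have : stack E D (outer y) a ↔ stack E D (outer y) b :=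
        ⟨fun h' => (stack E D).trans h' h, fun h' => (stack E D).trans h' ((stack E D).symm h)⟩
      simp only [this])
    (fun a => by
      by_cases ha : stack E D (outer x) a
      · have : ¬ stack E D (outer y) a := fun hb =>
          hdis ((stack E D).trans ha ((stack E D).symm hb))
        simp [this]
      · simp [ha])
  have hcl : ∀ w z : Fin m ⊕ Fin k, (if stack E D (outer w) (outer z) then (1 : ZMod 2) else 0)
      = (if z = w then 1 else 0) + (if z = compPartner E D w then 1 else 0) := by
    intro w z
    by_cases hw : z = w
    · subst hw
      rw [if_pos ((stack E D).refl _), if_pos rfl, if_neg (compPartner_ne E D z).symm, add_zero]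
    · by_cases hw' : z = compPartner E D w
      · rw [hw', if_pos (stack_compPartner E D w), if_neg (compPartner_ne E D w), if_pos rfl,
          zero_add]
      · rw [if_neg (fun h => hw' (eq_compPartner E D w z hw h)), if_neg hw, if_neg hw', add_zero]
  simp only [hcl, add_mul, mul_add, Finset.sum_add_distrib, ite_mul, mul_ite, one_mul, mul_one,
    zero_mul, mul_zero, Finset.sum_ite_eq', Finset.mem_univ, if_true] at hsum
  have t1 : chi (pos x) (pos y) = 1 := if_pos h1
  have t2 : chi (pos (compPartner E D x)) (pos y) = 0 := if_neg (by omega)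
  have t3 : chi (pos x) (pos (compPartner E D y)) = 1 := if_pos (by omega)
  have t4 : chi (pos (compPartner E D x)) (pos (compPartner E D y)) = 1 := if_pos h3
  rw [t1, t2, t3, t4] at hsum
  revert hsum
  decide

/-- The diagram obtained by stacking `E` on top of `D` and removing the closed loops. -/
def comp (E : Diagram n k) (D : Diagram m n) : Diagram m k where
  partner := compPartner E D
  partner_partner x := by
    symm
    exact eq_compPartner E D _ _ (compPartner_ne E D x).symm
      ((stack E D).symm (stack_compPartner E D x))
  partner_ne := compPartner_ne E D
  planar := comp_planar E D

/-- The number of closed loops of the closure of `D`, obtained by joining corresponding points on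
the top and bottom edges by disjoint arcs around the outside of `D`. -/
def closureLoops (D : Diagram n n) : ℕ :=
  Nat.card (Quotient (Relation.EqvGen.setoid fun a b : Fin n ⊕ Fin n =>
    D.partner a = b ∨ Sum.swap a = b))

end Diagram

/-! ### The Temperley-Lieb category -/

/-- `Hom(m, n)`: formal linear combinations of simple diagrams, where a closed loop is worth the
scalar `d`; every such combination is written in the basis of the loopless diagrams. -/
abbrev Hom (m n : ℕ) : Type := Diagram m n →₀ GroundField

/-- A loopless diagram as a morphism. -/
def ofDiagram {m n : ℕ} (D : Diagram m n) : Hom m n := Finsupp.single D 1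

/-- The identity morphism of `n`. -/
def idHom (n : ℕ) : Hom n n := ofDiagram (Diagram.one n)

/-- Composition, the bilinear extension of stacking; every closed loop becomes a factor `d`. -/
def comp {m n k : ℕ} : Hom n k →ₗ[GroundField] Hom m n →ₗ[GroundField] Hom m k :=
  Finsupp.linearCombination GroundField fun E : Diagram n k =>
    Finsupp.linearCombination GroundField fun D : Diagram m n =>
      loopVar ^ Diagram.loops E D • ofDiagram (Diagram.comp E D)

/-- Tensor product, the bilinear extension of juxtaposition. -/
def tensor {m n m' n' : ℕ} :
    Hom m n →ₗ[GroundField] Hom m' n' →ₗ[GroundField] Hom (m + m') (n + n') :=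
  Finsupp.linearCombination GroundField fun D : Diagram m n =>
    Finsupp.linearCombination GroundField fun E : Diagram m' n' =>
      ofDiagram (Diagram.tensor D E)

/-- The trace: the linear extension of closing up a diagram, with values in
`Hom(0, 0)`, which is identified with the ground field. -/
def trace {n : ℕ} : Hom n n →ₗ[GroundField] GroundField :=
  Finsupp.linearCombination GroundField fun D : Diagram n n =>
    loopVar ^ Diagram.closureLoops D

/-- `n` through-strings followed on the right by a cup. -/
def cupRight (n : ℕ) : Hom n (n + 2) := tensor (idHom n) (ofDiagram Diagram.cup)

/-- `n` through-strings followed on the right by a cap. -/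
def capRight (n : ℕ) : Hom (n + 2) n := tensor (idHom n) (ofDiagram Diagram.cap)

/-- The one-strand right trace: the rightmost top and bottom points are joined by an arc around the
right-hand side. -/
def partialTrace {n : ℕ} (f : Hom (n + 1) (n + 1)) : Hom n n :=
  comp (capRight n) (comp (tensor f (idHom 1)) (cupRight n))

/-- The Jones-Wenzl idempotents: `p_0` and `p_1` are identities and
`p_{n+2} = (p_{n+1} ⊗ 1) - [n+1]/[n+2] (p_{n+1} ⊗ 1) U_{n+1} (p_{n+1} ⊗ 1)`, where the diagram
`U_{n+1}` consists of `n` through-strings followed by a cup above a cap. -/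
def jonesWenzl : (n : ℕ) → Hom n n
  | 0 => idHom 0
  | 1 => idHom 1
  | n + 2 =>
    tensor (jonesWenzl (n + 1)) (idHom 1) -
      (quantumInt (n + 1) / quantumInt (n + 2)) •
        comp (tensor (jonesWenzl (n + 1)) (idHom 1))
          (comp (comp (cupRight n) (capRight n)) (tensor (jonesWenzl (n + 1)) (idHom 1)))

end TemperleyLieb

end

/-! Two independent arguments are combined: a way to verify identities between diagrams, and Wenzl's
induction.

Diagram identities (associativity, interchange, zigzag) are checked by counting two-colourings. A
diagram gives the 0-1 matrix of boundary colourings constant along its arcs. Stacking becomes the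
matrix product and closing up becomes the matrix trace, each closed loop contributing its 2
colourings (`colorMatrix_mul`, `trace_colorMatrix`). A single diagram with loops, `d ^ r • D`, is
recovered from `2 ^ r` times its matrix (`smul_colorMatrix_injective`). Nothing is claimed for
linear combinations, so each identity is first reduced to diagrams by linearity.

The induction carries idempotence, absorption of the predecessor and the partial trace together
(`jonesWenzl_properties`). Closing the last strand in the recursion gives `tr₁(p_{n+1}) = d p_n -
[n]/[n+1] p_n²`; idempotence of `p_n` and `[2][n+1] = [n+2] + [n]` yield the coefficient. That
coefficient is exactly what makes `p_{n+1}` annihilate the rightmost cup, and this gives its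
idempotence. The full trace follows by iterating partial traces. -/

namespace TemperleyLieb

/-! ### Colour matrices and their faithfulness on single diagrams -/

namespace Diagram

variable {m n k m' n' : ℕ}

/-- A two-colouring of the boundary points which is constant along the arcs of `D`. -/
def Compatible (D : Diagram m n) (a : Fin m ⊕ Fin n → Bool) : Prop :=
  ∀ x, a (D.partner x) = a x

open Classical in
/-- The zero-one matrix whose entries tell which two-colourings of the boundary points of `D` are
constant along its arcs. -/
noncomputable def colorMatrix (D : Diagram m n) : Matrix (Fin m → Bool) (Fin n → Bool) ℕ :=
  fun a b => if D.Compatible (Sum.elim a b) then 1 else 0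

theorem colorMatrix_of_compatible {D : Diagram m n} {a : Fin m → Bool} {b : Fin n → Bool}
    (h : D.Compatible (Sum.elim a b)) : D.colorMatrix a b = 1 := if_pos h

theorem colorMatrix_of_not_compatible {D : Diagram m n} {a : Fin m → Bool} {b : Fin n → Bool}
    (h : ¬ D.Compatible (Sum.elim a b)) : D.colorMatrix a b = 0 := if_neg h

/-- Colour one arc of `D` and nothing else. If `E` respects this colouring, the `E`-partner of one
end is coloured too, and being different from that end it is the other one. -/
theorem eq_of_compatible_imp {D E : Diagram m n} (h : ∀ a, D.Compatible a → E.Compatible a) :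
    D = E := by
  ext1
  funext x
  have hx : D.Compatible fun y => decide (y = x ∨ y = D.partner x) := by
    intro y
    have h1 : D.partner y = x ↔ y = D.partner x :=
      ⟨fun h => by rw [← h, D.partner_partner], fun h => by rw [h, D.partner_partner]⟩
    have h2 : D.partner y = D.partner x ↔ y = x :=
      ⟨fun h => by rw [← D.partner_partner y, h, D.partner_partner], fun h => by rw [h]⟩
    simp only [h1, h2, or_comm]
  have := h _ hx x
  simp only [true_or, decide_true, decide_eq_true_eq] at this
  exact (this.resolve_left (E.partner_ne x)).symm

/-- A diagram with loops is determined by its colour matrix, each loop counting as a factor `2`. -/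
theorem smul_colorMatrix_injective {D E : Diagram m n} {r s : ℕ}
    (h : 2 ^ r • D.colorMatrix = 2 ^ s • E.colorMatrix) : r = s ∧ D = E := by
  have h' : ∀ a b, 2 ^ r * D.colorMatrix a b = 2 ^ s * E.colorMatrix a b := fun a b =>
    congrFun (congrFun h a) b
  -- A constant colouring is compatible with every diagram, so this entry isolates the loop factor.
  have h0 := h' (fun _ => true) (fun _ => true)
  have hc : ∀ D : Diagram m n, D.colorMatrix (fun _ => true) (fun _ => true) = 1 := fun D => by
    refine colorMatrix_of_compatible fun x => ?_
    rcases D.partner x with i | i <;> rcases x with j | j <;> rfl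
  rw [hc, hc, mul_one, mul_one] at h0
  refine ⟨Nat.pow_right_injective le_rfl h0, eq_of_compatible_imp fun a ha => ?_⟩
  by_contra hE
  have ha' := h' (a ∘ Sum.inl) (a ∘ Sum.inr)
  rw [colorMatrix_of_compatible (by rwa [Sum.elim_comp_inl_inr]),
    colorMatrix_of_not_compatible (by rwa [Sum.elim_comp_inl_inr])] at ha'
  simp at ha'

/-! ### Stacking and closing as counting of colourings -/

theorem stack_invariant_iff (E : Diagram n k) (D : Diagram m n) (a : Fin m → Bool)
    (b : Fin n → Bool) (c : Fin k → Bool) :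
    (∀ x y, stack E D x y → (Sum.elim a (Sum.elim b c) x : Bool) = Sum.elim a (Sum.elim b c) y) ↔
      D.Compatible (Sum.elim a b) ∧ E.Compatible (Sum.elim b c) := by
  have hmap : ∀ x : Fin m ⊕ Fin n,
      Sum.elim a (Sum.elim b c) (Sum.map id Sum.inl x) = Sum.elim a b x := by
    rintro (i | i) <;> rfl
  constructor
  · refine fun h => ⟨fun x => ?_, fun x => ?_⟩
    · rw [← hmap, ← hmap]
      exact (h _ _ (.rel _ _ (Or.inl (lowerArc_map D x)))).symm
    · exact (h (Sum.inr x) (Sum.inr (E.partner x)) (.rel _ _ (Or.inr rfl))).symm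
  · rintro ⟨hD, hE⟩ x y hxy
    induction hxy with
    | rel x y h =>
      rcases h with rfl | rfl
      · rcases x with i | i | i
        · exact ((hmap _).trans (hD (Sum.inl i))).symm
        · exact ((hmap _).trans (hD (Sum.inr i))).symm
        · rfl
      · rcases x with i | i
        · rfl
        · exact (hE i).symm
    | refl x => rfl
    | symm x y _ ih => exact ih.symm
    | trans x y z _ _ ih1 ih2 => exact ih1.trans ih2

theorem stack_outer_iff (E : Diagram n k) (D : Diagram m n) (x y : Fin m ⊕ Fin k) :
    stack E D (outer x) (outer y) ↔ y = x ∨ y = compPartner E D x := by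
  constructor
  · intro h
    by_cases hyx : y = x
    · exact Or.inl hyx
    · exact Or.inr (eq_compPartner E D x y hyx h)
  · rintro (rfl | rfl)
    · exact (stack E D).refl _
    · exact stack_compPartner E D x

/-- The two-colourings of a stacked picture extending a given colouring of the boundary correspond
to the two-colourings of the closed loops. -/
theorem card_colorings_stack (E : Diagram n k) (D : Diagram m n) (a : Fin m → Bool)
    (c : Fin k → Bool) (h : (comp E D).Compatible (Sum.elim a c)) :
    Nat.card {b : Fin n → Bool // D.Compatible (Sum.elim a b) ∧ E.Compatible (Sum.elim b c)} =
      2 ^ loops E D := by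
  classical
  have hcard : 2 ^ loops E D = Nat.card ({q : Quotient (stack E D) //
      ∀ x : Fin m ⊕ Fin k, (Quotient.mk (stack E D) (outer x)) ≠ q} → Bool) := by
    rw [Nat.card_fun, Nat.card_eq_fintype_card (α := Bool), Fintype.card_bool, loops]
  rw [hcard]
  have houter : ∀ (b : Fin n → Bool) (x : Fin m ⊕ Fin k),
      Sum.elim a (Sum.elim b c) (outer x) = Sum.elim a c x := by
    rintro b (i | i) <;> rfl
  -- The bijection restricts a colouring of the curves to the closed loops. It is injective because
  -- a middle point off the loops lies on a curve whose colour is already fixed at the boundary.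
  refine Nat.card_eq_of_bijective (fun b q => Quotient.lift (Sum.elim a (Sum.elim b.1 c))
    ((stack_invariant_iff E D a b.1 c).2 b.2) q.1) ⟨?_, ?_⟩
  · rintro ⟨b, hb⟩ ⟨b', hb'⟩ hbb
    refine Subtype.ext (funext fun j => ?_)
    change b j = b' j
    by_cases hj : ∀ x : Fin m ⊕ Fin k, (Quotient.mk (stack E D) (outer x)) ≠
        Quotient.mk (stack E D) (Sum.inr (Sum.inl j))
    · exact congrFun hbb ⟨_, hj⟩
    · push Not at hj
      obtain ⟨x, hx⟩ := hj
      have hx := Quotient.exact hx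
      have e1 := (stack_invariant_iff E D a b c).2 hb _ _ hx
      have e2 := (stack_invariant_iff E D a b' c).2 hb' _ _ hx
      rw [houter] at e1 e2
      exact e1.symm.trans e2
  · intro g
    -- For surjectivity, a curve reaching the boundary takes the colour of a chosen end. By `h` its
    -- two ends agree, so the choice does not matter.
    set γ : Quotient (stack E D) → Bool := fun q =>
      if hq : ∃ x : Fin m ⊕ Fin k, Quotient.mk (stack E D) (outer x) = q
      then Sum.elim a c hq.choose else g ⟨q, fun x hx => hq ⟨x, hx⟩⟩ with hγ
    have hγo : ∀ x : Fin m ⊕ Fin k, γ (Quotient.mk _ (outer x)) = Sum.elim a c x := by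
      intro x
      have hq : ∃ y : Fin m ⊕ Fin k, Quotient.mk (stack E D) (outer y) =
        Quotient.mk (stack E D) (outer x) := ⟨x, rfl⟩
      simp only [hγ, dif_pos hq]
      rcases (stack_outer_iff E D x _).1 (Quotient.exact hq.choose_spec.symm) with hy | hy
      · rw [hy]
      · rw [hy]; exact h x
    set b : Fin n → Bool := fun j => γ (Quotient.mk _ (Sum.inr (Sum.inl j))) with hb
    have hbγ : ∀ x, Sum.elim a (Sum.elim b c) x = γ (Quotient.mk _ x) := by
      rintro (i | i | i)
      · exact (hγo (Sum.inl i)).symm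
      · rfl
      · exact (hγo (Sum.inr i)).symm
    refine ⟨⟨b, (stack_invariant_iff E D a b c).1 fun x y hxy => ?_⟩, funext fun ⟨q, hq⟩ => ?_⟩
    · rw [hbγ, hbγ, Quotient.sound hxy]
    · induction q using Quotient.inductionOn with
      | h x =>
        change Sum.elim a (Sum.elim b c) x = _
        rw [hbγ]
        exact dif_neg (fun ⟨y, hy⟩ => hq y hy)

/-- An entry of the product counts the colourings of the middle points compatible with both
diagrams. There are none if some curve has ends of different colours; otherwise only the closed
loops are free. -/
theorem colorMatrix_mul (E : Diagram n k) (D : Diagram m n) :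
    D.colorMatrix * E.colorMatrix = 2 ^ loops E D • (comp E D).colorMatrix := by
  classical
  ext a c
  have hsum : (D.colorMatrix * E.colorMatrix) a c = Nat.card {b : Fin n → Bool //
      D.Compatible (Sum.elim a b) ∧ E.Compatible (Sum.elim b c)} := by
    rw [Matrix.mul_apply, Nat.card_eq_fintype_card, Fintype.card_subtype, Finset.card_filter]
    refine Finset.sum_congr rfl fun b _ => ?_
    by_cases h1 : D.Compatible (Sum.elim a b) <;> by_cases h2 : E.Compatible (Sum.elim b c) <;>
      simp [colorMatrix, h1, h2]
  rw [hsum, Matrix.smul_apply]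
  by_cases h : (comp E D).Compatible (Sum.elim a c)
  · rw [card_colorings_stack E D a c h, colorMatrix_of_compatible h, smul_eq_mul, mul_one]
  · rw [colorMatrix_of_not_compatible h, smul_zero, Nat.card_eq_zero]
    refine Or.inl ⟨fun ⟨b, hb⟩ => h fun x => ?_⟩
    have := (stack_invariant_iff E D a b c).2 hb _ _ (stack_compPartner E D x)
    have houter : ∀ x : Fin m ⊕ Fin k,
        Sum.elim a (Sum.elim b c) (outer x) = Sum.elim a c x := by
      rintro (i | i) <;> rfl
    rw [houter, houter] at this
    exact this.symm

/-- The trace counts colourings with equal top and bottom that are constant along arcs, i.e.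
colourings of the closure, where every curve is a loop and is coloured freely. -/
theorem trace_colorMatrix (D : Diagram n n) : D.colorMatrix.trace = 2 ^ closureLoops D := by
  classical
  have hcard : 2 ^ closureLoops D = Nat.card (Quotient (Relation.EqvGen.setoid
      fun a b : Fin n ⊕ Fin n => D.partner a = b ∨ Sum.swap a = b) → Bool) := by
    rw [Nat.card_fun, Nat.card_eq_fintype_card (α := Bool), Fintype.card_bool, closureLoops]
  have hinv : ∀ a : Fin n → Bool, D.Compatible (Sum.elim a a) → ∀ x y : Fin n ⊕ Fin n,
      Relation.EqvGen (fun a b : Fin n ⊕ Fin n => D.partner a = b ∨ Sum.swap a = b) x y →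
        Sum.elim a a x = Sum.elim a a y := by
    intro a ha x y hxy
    induction hxy with
    | rel x y h =>
      rcases h with rfl | rfl
      · exact (ha x).symm
      · rcases x with i | i <;> rfl
    | refl x => rfl
    | symm x y _ ih => exact ih.symm
    | trans x y z _ _ ih1 ih2 => exact ih1.trans ih2
  have hsum : D.colorMatrix.trace =
      Nat.card {a : Fin n → Bool // D.Compatible (Sum.elim a a)} := by
    rw [Nat.card_eq_fintype_card, Fintype.card_subtype, Finset.card_filter]
    exact Finset.sum_congr rfl fun a _ => by simp [colorMatrix]
  rw [hsum, hcard]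
  refine Nat.card_eq_of_bijective (fun a => Quotient.lift (Sum.elim a.1 a.1) (hinv a.1 a.2))
    ⟨?_, ?_⟩
  · rintro ⟨a, ha⟩ ⟨b, hb⟩ hab
    exact Subtype.ext (funext fun i => congrFun hab (Quotient.mk _ (Sum.inl i)))
  · intro g
    have hg : ∀ x : Fin n ⊕ Fin n, Sum.elim (fun i => g (Quotient.mk _ (Sum.inl i)))
        (fun i => g (Quotient.mk _ (Sum.inl i))) x = g (Quotient.mk _ x) := by
      rintro (i | i)
      · rfl
      · exact congrArg g (Quotient.sound (.rel _ _ (Or.inr rfl)))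
    refine ⟨⟨fun i => g (Quotient.mk _ (Sum.inl i)), fun x => ?_⟩, funext fun q => ?_⟩
    · rw [hg, hg]
      exact congrArg g (Quotient.sound (.symm _ _ (.rel _ _ (Or.inl rfl))))
    · induction q using Quotient.inductionOn with
      | h x => exact hg x

/-! ### Colour matrices of juxtapositions and of the elementary diagrams -/

theorem compatible_tensor (D : Diagram m n) (E : Diagram m' n')
    (a : Fin (m + m') ⊕ Fin (n + n') → Bool) :
    (tensor D E).Compatible a ↔
      D.Compatible (fun x => a ((split m n m' n').symm (Sum.inl x))) ∧
      E.Compatible (fun x => a ((split m n m' n').symm (Sum.inr x))) := by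
  simp only [Compatible, tensor]
  rw [(split m n m' n').symm.surjective.forall
    (p := fun x => a ((split m n m' n').symm (Sum.map D.partner E.partner
      (split m n m' n' x))) = a x)]
  simp

theorem colorMatrix_tensor (D : Diagram m n) (E : Diagram m' n')
    (a : Fin (m + m') → Bool) (b : Fin (n + n') → Bool) :
    (tensor D E).colorMatrix a b =
      D.colorMatrix (a ∘ Fin.castAdd m') (b ∘ Fin.castAdd n') *
        E.colorMatrix (a ∘ Fin.natAdd m) (b ∘ Fin.natAdd n) := by
  classical
  have h1 : (fun x => Sum.elim a b ((split m n m' n').symm (Sum.inl x))) =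
      Sum.elim (a ∘ Fin.castAdd m') (b ∘ Fin.castAdd n') := by
    funext x; rcases x with i | i <;> simp [split]
  have h2 : (fun x => Sum.elim a b ((split m n m' n').symm (Sum.inr x))) =
      Sum.elim (a ∘ Fin.natAdd m) (b ∘ Fin.natAdd n) := by
    funext x; rcases x with i | i <;> simp [split]
  simp only [colorMatrix, compatible_tensor, h1, h2, ite_and, ite_mul, one_mul, zero_mul]

theorem colorMatrix_one (n : ℕ) : (one n).colorMatrix = 1 := by
  classical
  ext a b
  rw [Matrix.one_apply, colorMatrix]
  refine if_congr ⟨fun h => funext fun i => (h (Sum.inr i)), ?_⟩ rfl rfl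
  rintro rfl (i | i) <;> rfl

theorem colorMatrix_cup (a : Fin 0 → Bool) (b : Fin 2 → Bool) :
    cup.colorMatrix a b = if b 0 = b 1 then 1 else 0 := by
  classical
  refine if_congr ⟨fun h => h (Sum.inr 1), fun h => ?_⟩ rfl rfl
  rintro (i | i)
  · exact i.elim0
  · fin_cases i
    · exact h.symm
    · exact h

theorem colorMatrix_cap (a : Fin 2 → Bool) (b : Fin 0 → Bool) :
    cap.colorMatrix a b = if a 0 = a 1 then 1 else 0 := by
  classical
  refine if_congr ⟨fun h => h (Sum.inl 1), fun h => ?_⟩ rfl rfl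
  rintro (i | i)
  · fin_cases i
    · exact h.symm
    · exact h
  · exact i.elim0

end Diagram

variable {m n k m' n' : ℕ}

/-! ### Morphisms represented by integer matrices -/

theorem comp_ofDiagram (E : Diagram n k) (D : Diagram m n) :
    comp (ofDiagram E) (ofDiagram D) =
      loopVar ^ Diagram.loops E D • ofDiagram (Diagram.comp E D) := by
  simp [comp, ofDiagram]

theorem tensor_ofDiagram (D : Diagram m n) (E : Diagram m' n') :
    tensor (ofDiagram D) (ofDiagram E) = ofDiagram (Diagram.tensor D E) := by
  simp [tensor, ofDiagram]

theorem trace_ofDiagram (D : Diagram n n) :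
    trace (ofDiagram D) = loopVar ^ Diagram.closureLoops D := by
  simp [trace, ofDiagram]

/-- `f` is a diagram with loops, and `M` is its colour matrix. -/
def Represents (f : Hom m n) (M : Matrix (Fin m → Bool) (Fin n → Bool) ℕ) : Prop :=
  ∃ (r : ℕ) (D : Diagram m n), f = loopVar ^ r • ofDiagram D ∧ M = 2 ^ r • D.colorMatrix

namespace Represents

theorem ofDiagram (D : Diagram m n) : Represents (ofDiagram D) D.colorMatrix :=
  ⟨0, D, by simp, by simp⟩

/-- The transfer principle: an identity between diagrams with loops, for generic `d`, may be checked
on natural-number matrices at `d = 2`, because the exponent of `2` still records the loops. -/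
theorem unique {f g : Hom m n} {M N : Matrix (Fin m → Bool) (Fin n → Bool) ℕ}
    (hf : Represents f M) (hg : Represents g N) (h : M = N) : f = g := by
  obtain ⟨r, D, rfl, rfl⟩ := hf
  obtain ⟨s, E, rfl, rfl⟩ := hg
  obtain ⟨rfl, rfl⟩ := Diagram.smul_colorMatrix_injective h
  rfl

theorem congr {f : Hom m n} {M N : Matrix (Fin m → Bool) (Fin n → Bool) ℕ}
    (hf : Represents f M) (h : ∀ a b, M a b = N a b) : Represents f N := by
  rwa [← show M = N from Matrix.ext h]

/-- Rows are indexed by bottom colourings, so the order of the factors is reversed. -/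
theorem comp {g : Hom n k} {f : Hom m n} {M : Matrix (Fin m → Bool) (Fin n → Bool) ℕ}
    {N : Matrix (Fin n → Bool) (Fin k → Bool) ℕ} (hg : Represents g N) (hf : Represents f M) :
    Represents (comp g f) (M * N) := by
  obtain ⟨r, D, rfl, rfl⟩ := hf
  obtain ⟨s, E, rfl, rfl⟩ := hg
  refine ⟨r + s + Diagram.loops E D, Diagram.comp E D, ?_, ?_⟩
  · simp only [map_smul, LinearMap.smul_apply, comp_ofDiagram, smul_smul, ← pow_add, add_assoc]
  · rw [Matrix.smul_mul, Matrix.mul_smul, Diagram.colorMatrix_mul, smul_smul, smul_smul, pow_add,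
      pow_add, mul_assoc]

theorem tensor {f : Hom m n} {g : Hom m' n'} {M : Matrix (Fin m → Bool) (Fin n → Bool) ℕ}
    {N : Matrix (Fin m' → Bool) (Fin n' → Bool) ℕ} (hf : Represents f M) (hg : Represents g N) :
    Represents (tensor f g) <| .of fun a b => M (a ∘ Fin.castAdd m') (b ∘ Fin.castAdd n') *
      N (a ∘ Fin.natAdd m) (b ∘ Fin.natAdd n) := by
  obtain ⟨r, D, rfl, rfl⟩ := hf
  obtain ⟨s, E, rfl, rfl⟩ := hg
  refine ⟨r + s, Diagram.tensor D E, ?_, ?_⟩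
  · simp only [map_smul, LinearMap.smul_apply, tensor_ofDiagram, smul_smul, ← pow_add, add_comm s r]
  · ext a b
    simp only [Matrix.of_apply, Matrix.smul_apply, Diagram.colorMatrix_tensor, smul_eq_mul, pow_add]
    ring

theorem smul_loopVar {f : Hom m n} {M : Matrix (Fin m → Bool) (Fin n → Bool) ℕ}
    (hf : Represents f M) : Represents (loopVar • f) (2 • M) := by
  obtain ⟨r, D, rfl, rfl⟩ := hf
  exact ⟨r + 1, D, by rw [smul_smul, pow_succ'], by rw [smul_smul, pow_succ']⟩

/-- Both matrix traces are powers of `2` whose exponents count all loops after closing; equal powers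
force equal exponents, hence equal powers of `d`. -/
theorem trace_eq {f : Hom m m} {g : Hom n n} {M : Matrix (Fin m → Bool) (Fin m → Bool) ℕ}
    {N : Matrix (Fin n → Bool) (Fin n → Bool) ℕ} (hf : Represents f M) (hg : Represents g N)
    (h : M.trace = N.trace) : trace f = trace g := by
  obtain ⟨r, D, rfl, rfl⟩ := hf
  obtain ⟨s, E, rfl, rfl⟩ := hg
  rw [Matrix.trace_smul, Matrix.trace_smul, Diagram.trace_colorMatrix, Diagram.trace_colorMatrix,
    smul_eq_mul, smul_eq_mul, ← pow_add, ← pow_add] at h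
  have := Nat.pow_right_injective le_rfl h
  rw [map_smul, map_smul, trace_ofDiagram, trace_ofDiagram, smul_eq_mul, smul_eq_mul, ← pow_add,
    ← pow_add, this]

theorem idHom (n : ℕ) : Represents (idHom n) 1 := by
  rw [← Diagram.colorMatrix_one]
  exact .ofDiagram _

theorem tensor_idHom_one {f : Hom m n} {M : Matrix (Fin m → Bool) (Fin n → Bool) ℕ}
    (hf : Represents f M) : Represents (TemperleyLieb.tensor f (TemperleyLieb.idHom 1))
      (.of fun a b => if a (Fin.last m) = b (Fin.last n) then
        M (Fin.init a) (Fin.init b) else 0) := by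
  refine (hf.tensor (.idHom 1)).congr fun a b => ?_
  have h : a ∘ Fin.natAdd m = b ∘ Fin.natAdd n ↔ a (Fin.last m) = b (Fin.last n) := by
    refine ⟨fun h => congrFun h 0, fun h => funext fun i => ?_⟩
    rw [Subsingleton.elim i 0]
    exact h
  rw [Matrix.of_apply, Matrix.of_apply, Matrix.one_apply, mul_ite, mul_one, mul_zero]
  exact if_congr h rfl rfl

theorem cupRight (n : ℕ) : Represents (cupRight n)
    (.of fun a b => if a = Fin.init (Fin.init b) ∧
      Fin.init b (Fin.last n) = b (Fin.last (n + 1)) then 1 else 0) := by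
  refine ((Represents.idHom n).tensor (.ofDiagram Diagram.cup)).congr fun a b => ?_
  rw [Matrix.of_apply, Matrix.of_apply, Matrix.one_apply, Diagram.colorMatrix_cup, ite_and, ite_mul, one_mul,
    zero_mul]
  rfl

theorem capRight (n : ℕ) : Represents (capRight n)
    (.of fun a b => if Fin.init (Fin.init a) = b ∧
      Fin.init a (Fin.last n) = a (Fin.last (n + 1)) then 1 else 0) := by
  refine ((Represents.idHom n).tensor (.ofDiagram Diagram.cap)).congr fun a b => ?_
  rw [Matrix.of_apply, Matrix.of_apply, Matrix.one_apply, Diagram.colorMatrix_cap, ite_and, ite_mul, one_mul,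
    zero_mul]
  rfl

end Represents

/-- Summation over the colourings of `n + 1` points, splitting off the rightmost point. -/
theorem sum_colorings_succ (f : (Fin (n + 1) → Bool) → ℕ) :
    ∑ a, f a = ∑ a : Fin n → Bool, ∑ t : Bool, f (Fin.snoc (α := fun _ => Bool) a t) := by
  rw [← (Fin.snocEquiv fun _ : Fin (n + 1) => Bool).sum_comp, Fintype.sum_prod_type_right]
  rfl

namespace Represents

/-- The cap identifies the colours of the last two points and sums over the common value. -/
theorem capRight_comp {f : Hom m (n + 2)}
    {M : Matrix (Fin m → Bool) (Fin (n + 2) → Bool) ℕ} (hf : Represents f M) :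
    Represents (TemperleyLieb.comp (TemperleyLieb.capRight n) f)
      <| .of fun a b => ∑ t : Bool, M a (Fin.snoc (α := fun _ => Bool)
        (Fin.snoc (α := fun _ => Bool) b t : Fin (n + 1) → Bool) t) := by
  refine ((capRight n).comp hf).congr fun a b => ?_
  rw [Matrix.mul_apply]
  simp [sum_colorings_succ, ite_and]

theorem comp_cupRight {f : Hom (m + 2) n}
    {M : Matrix (Fin (m + 2) → Bool) (Fin n → Bool) ℕ} (hf : Represents f M) :
    Represents (TemperleyLieb.comp f (TemperleyLieb.cupRight m))
      <| .of fun a b => ∑ t : Bool, M (Fin.snoc (α := fun _ => Bool)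
        (Fin.snoc (α := fun _ => Bool) a t : Fin (m + 1) → Bool) t) b := by
  refine (hf.comp (cupRight m)).congr fun a b => ?_
  rw [Matrix.mul_apply]
  simp [sum_colorings_succ, ite_and]

theorem partialTrace {f : Hom (n + 1) (n + 1)}
    {M : Matrix (Fin (n + 1) → Bool) (Fin (n + 1) → Bool) ℕ} (hf : Represents f M) :
    Represents (partialTrace f) <| .of fun a b => ∑ t : Bool,
      M (Fin.snoc (α := fun _ => Bool) a t) (Fin.snoc (α := fun _ => Bool) b t) := by
  refine (capRight_comp (comp_cupRight hf.tensor_idHom_one)).congr fun a b => ?_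
  simp

end Represents

/-! ### Relations between morphisms -/

theorem Hom.induction {P : Hom m n → Prop} (f : Hom m n) (diagram : ∀ D, P (ofDiagram D))
    (zero : P 0) (add : ∀ f g, P f → P g → P (f + g)) (smul : ∀ (c : GroundField) f, P f → P (c • f)) : P f := by
  induction f using Finsupp.induction_linear with
  | zero => exact zero
  | add f g hf hg => exact add f g hf hg
  | single D c =>
    have := smul c _ (diagram D)
    rwa [ofDiagram, Finsupp.smul_single, smul_eq_mul, mul_one] at this

/-- Associativity of matrix multiplication handles the resulting diagram and the loop count at once,
with no tracing of curves. -/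
theorem comp_assoc {l : ℕ} (h : Hom k l) (g : Hom n k) (f : Hom m n) :
    comp (comp h g) f = comp h (comp g f) := by
  induction h using Hom.induction with
  | zero => simp
  | add h h' e e' => simp only [map_add, LinearMap.add_apply, e, e']
  | smul c h e => simp only [map_smul, LinearMap.smul_apply, e]
  | diagram H =>
    induction g using Hom.induction with
    | zero => simp
    | add g g' e e' => simp only [map_add, LinearMap.add_apply, e, e']
    | smul c g e => simp only [map_smul, LinearMap.smul_apply, e]
    | diagram G =>
      induction f using Hom.induction with
      | zero => simp
      | add f f' e e' => simp only [map_add, e, e']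
      | smul c f e => simp only [map_smul, e]
      | diagram F =>
        have hF := Represents.ofDiagram F
        have hG := Represents.ofDiagram G
        have hH := Represents.ofDiagram H
        exact ((hH.comp hG).comp hF).unique (hH.comp (hG.comp hF)) (Matrix.mul_assoc _ _ _).symm

theorem idHom_comp (f : Hom m n) : comp (idHom n) f = f := by
  induction f using Hom.induction with
  | zero => simp
  | add f f' e e' => simp only [map_add, e, e']
  | smul c f e => simp only [map_smul, e]
  | diagram F =>
    have hF := Represents.ofDiagram F
    exact ((Represents.idHom n).comp hF).unique hF (Matrix.mul_one _)

theorem tensor_idHom (n : ℕ) : tensor (idHom n) (idHom 1) = idHom (n + 1) := by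
  refine (Represents.idHom n).tensor_idHom_one.unique (.idHom (n + 1)) ?_
  ext a b
  simp only [Matrix.one_apply, ← ite_and]
  refine if_congr ⟨fun h => ?_, ?_⟩ rfl rfl
  · rw [← Fin.snoc_init_self a, ← Fin.snoc_init_self b, h.1, h.2]
  · rintro rfl
    exact ⟨rfl, rfl⟩

theorem tensor_comp (g : Hom n k) (f : Hom m n) :
    tensor (comp g f) (idHom 1) = comp (tensor g (idHom 1)) (tensor f (idHom 1)) := by
  induction g using Hom.induction with
  | zero => simp
  | add g g' e e' => simp only [map_add, LinearMap.add_apply, e, e']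
  | smul c g e => simp only [map_smul, LinearMap.smul_apply, e]
  | diagram G =>
    induction f using Hom.induction with
    | zero => simp
    | add f f' e e' => simp only [map_add, LinearMap.add_apply, e, e']
    | smul c f e => simp only [map_smul, LinearMap.smul_apply, e]
    | diagram F =>
      have hF := Represents.ofDiagram F
      have hG := Represents.ofDiagram G
      refine (hG.comp hF).tensor_idHom_one.unique
        (hG.tensor_idHom_one.comp hF.tensor_idHom_one) ?_
      ext a b
      rw [Matrix.mul_apply]
      simp [Matrix.mul_apply, sum_colorings_succ]

theorem partialTrace_add (f g : Hom (n + 1) (n + 1)) :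
    partialTrace (f + g) = partialTrace f + partialTrace g := by
  simp only [partialTrace, map_add, LinearMap.add_apply]

theorem partialTrace_smul (c : GroundField) (f : Hom (n + 1) (n + 1)) :
    partialTrace (c • f) = c • partialTrace f := by
  simp only [partialTrace, map_smul, LinearMap.smul_apply]

theorem partialTrace_tensor (f : Hom n n) :
    partialTrace (tensor f (idHom 1)) = loopVar • f := by
  induction f using Hom.induction with
  | zero => simp [partialTrace]
  | add f f' e e' => simp only [map_add, LinearMap.add_apply, partialTrace_add, smul_add, e, e']
  | smul c f e =>
    rw [map_smul, LinearMap.smul_apply, partialTrace_smul, e, smul_comm]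
  | diagram F =>
    have hF := Represents.ofDiagram F
    refine hF.tensor_idHom_one.partialTrace.unique hF.smul_loopVar ?_
    ext a b
    simp

/-- Zigzag: the closing arc joins the cup below `g` to the cap above `f` into one through-string,
leaving `g` directly on top of `f` without a loop. -/
theorem partialTrace_tensor_comp_cup_cap (g f : Hom (n + 1) (n + 1)) :
    partialTrace (comp (tensor g (idHom 1)) (comp (comp (cupRight n) (capRight n))
      (tensor f (idHom 1)))) = comp g f := by
  -- Regrouping as `(g ⊗ 1) ∘ cup` after `cap ∘ (f ⊗ 1)`, the two shapes whose matrices are known.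
  rw [comp_assoc, ← comp_assoc]
  induction g using Hom.induction with
  | zero => simp [partialTrace]
  | add g g' e e' => simp only [map_add, LinearMap.add_apply, partialTrace_add, e, e']
  | smul c g e => simp only [map_smul, LinearMap.smul_apply, partialTrace_smul, e]
  | diagram G =>
    induction f using Hom.induction with
    | zero => simp [partialTrace]
    | add f f' e e' => simp only [map_add, LinearMap.add_apply, partialTrace_add, e, e']
    | smul c f e => simp only [map_smul, LinearMap.smul_apply, partialTrace_smul, e]
    | diagram F =>
      have hF := Represents.ofDiagram F
      have hG := Represents.ofDiagram G
      refine (hG.tensor_idHom_one.comp_cupRight.comp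
        hF.tensor_idHom_one.capRight_comp).partialTrace.unique (hG.comp hF) ?_
      ext a b
      rw [Matrix.mul_apply]
      simp [Matrix.mul_apply, sum_colorings_succ, Finset.sum_add_distrib]

/-- Interchange law: `f` and the cup occupy disjoint strands, so `f` slides past it. -/
theorem cupRight_comp (f : Hom n n) :
    comp (cupRight n) f = comp (tensor (tensor f (idHom 1)) (idHom 1)) (cupRight n) := by
  induction f using Hom.induction with
  | zero => simp
  | add f f' e e' => simp only [map_add, LinearMap.add_apply, e, e']
  | smul c f e => simp only [map_smul, LinearMap.smul_apply, e]
  | diagram F =>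
    have hF := Represents.ofDiagram F
    refine ((Represents.cupRight n).comp hF).unique
      hF.tensor_idHom_one.tensor_idHom_one.comp_cupRight ?_
    ext a b
    rw [Matrix.mul_apply]
    simp [ite_and]
    exact if_congr eq_comm rfl rfl

theorem trace_partialTrace (f : Hom (n + 1) (n + 1)) : trace (partialTrace f) = trace f := by
  induction f using Hom.induction with
  | zero => simp [partialTrace]
  | add f f' e e' => simp only [partialTrace_add, map_add, e, e']
  | smul c f e => simp only [partialTrace_smul, map_smul, e]
  | diagram F =>
    have hF := Represents.ofDiagram F
    refine hF.partialTrace.trace_eq hF ?_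
    simp only [Matrix.trace, Matrix.diag_apply]
    exact (sum_colorings_succ fun a => F.colorMatrix a a).symm

/-! ### Quantum integers -/

theorem q_ne_zero : q ≠ 0 := RatFunc.X_ne_zero

theorem q_pow_ne_one {n : ℕ} (hn : n ≠ 0) : q ^ n ≠ 1 := by
  intro h
  rw [q, ← RatFunc.algebraMap_X, ← map_pow, ← map_one (algebraMap (Polynomial ℂ) (RatFunc ℂ))] at h
  have := congrArg Polynomial.natDegree (RatFunc.algebraMap_injective ℂ h)
  rw [Polynomial.natDegree_X_pow, Polynomial.natDegree_one] at this
  exact hn this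

/-- Vanishing would give `q ^ (2n) = 1`, impossible for an indeterminate. -/
theorem q_pow_sub_ne_zero {n : ℕ} (hn : n ≠ 0) : q ^ n - q⁻¹ ^ n ≠ 0 := by
  intro h
  have h2 : q ^ n = (q ^ n)⁻¹ := by rw [← inv_pow]; exact sub_eq_zero.1 h
  refine q_pow_ne_one (n := n + n) (by omega) ?_
  rw [pow_add]
  nth_rw 1 [h2]
  exact inv_mul_cancel₀ (pow_ne_zero _ q_ne_zero)

theorem q_sub_inv_ne_zero : q - q⁻¹ ≠ 0 := by
  simpa using q_pow_sub_ne_zero one_ne_zero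

theorem quantumInt_ne_zero {n : ℕ} (hn : n ≠ 0) : quantumInt n ≠ 0 :=
  div_ne_zero (q_pow_sub_ne_zero hn) q_sub_inv_ne_zero

theorem quantumInt_one : quantumInt 1 = 1 := by
  rw [quantumInt, pow_one, pow_one, div_self q_sub_inv_ne_zero]

theorem loopVar_mul_quantumInt (n : ℕ) :
    loopVar * quantumInt (n + 1) = quantumInt (n + 2) + quantumInt n := by
  have h := q_sub_inv_ne_zero
  have hq : q * q⁻¹ = 1 := mul_inv_cancel₀ q_ne_zero
  have hd : loopVar = q + q⁻¹ := by
    rw [loopVar, quantumInt, div_eq_iff h]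
    ring
  rw [hd, quantumInt, quantumInt, quantumInt, ← add_div, ← mul_div_assoc]
  congr 1
  simp only [pow_succ]
  linear_combination (q ^ n - q⁻¹ ^ n) * hq

/-! ### Jones-Wenzl idempotents -/

theorem jonesWenzl_succ_succ (n : ℕ) : jonesWenzl (n + 2) =
    tensor (jonesWenzl (n + 1)) (idHom 1) - (quantumInt (n + 1) / quantumInt (n + 2)) •
      comp (tensor (jonesWenzl (n + 1)) (idHom 1))
        (comp (comp (cupRight n) (capRight n)) (tensor (jonesWenzl (n + 1)) (idHom 1))) := by
  rw [jonesWenzl]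

/-- The first term of the recursion closes to a loop, the second to `p_{n+1}²`, so the coefficient
is `[2] - [n+1]/[n+2]`. -/
theorem partialTrace_jonesWenzl_of_idempotent (n : ℕ)
    (h : comp (jonesWenzl (n + 1)) (jonesWenzl (n + 1)) = jonesWenzl (n + 1)) :
    partialTrace (jonesWenzl (n + 2)) =
      (quantumInt (n + 3) / quantumInt (n + 2)) • jonesWenzl (n + 1) := by
  rw [jonesWenzl_succ_succ, sub_eq_add_neg, ← neg_smul, partialTrace_add, partialTrace_smul,
    partialTrace_tensor, partialTrace_tensor_comp_cup_cap, h, ← add_smul]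
  congr 1
  have h2 := quantumInt_ne_zero (n := n + 2) (by omega)
  have h3 := loopVar_mul_quantumInt (n + 1)
  field_simp
  linear_combination h3

theorem partialTrace_jonesWenzl_one :
    partialTrace (jonesWenzl 1) = (quantumInt 2 / quantumInt 1) • jonesWenzl 0 := by
  rw [quantumInt_one, div_one, jonesWenzl, jonesWenzl, ← tensor_idHom 0, partialTrace_tensor]
  rfl

/-- The absorption `p_{n+2} (p_{n+1} ⊗ 1) = p_{n+2}`, given that `p_{n+1}` is idempotent. -/
theorem jonesWenzl_comp_tensor_of_idempotent (n : ℕ)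
    (h : comp (jonesWenzl (n + 1)) (jonesWenzl (n + 1)) = jonesWenzl (n + 1)) :
    comp (jonesWenzl (n + 2)) (tensor (jonesWenzl (n + 1)) (idHom 1)) = jonesWenzl (n + 2) := by
  rw [jonesWenzl_succ_succ]
  simp only [map_sub, map_smul, LinearMap.sub_apply, LinearMap.smul_apply, comp_assoc,
    ← tensor_comp, h]

/-- The Jones-Wenzl elements are idempotent, absorb their predecessors, and have partial traces
proportional to their predecessors. -/
theorem jonesWenzl_properties (n : ℕ) :
    comp (jonesWenzl (n + 1)) (jonesWenzl (n + 1)) = jonesWenzl (n + 1) ∧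
    comp (jonesWenzl (n + 1)) (tensor (jonesWenzl n) (idHom 1)) = jonesWenzl (n + 1) ∧
    partialTrace (jonesWenzl (n + 1)) =
      (quantumInt (n + 2) / quantumInt (n + 1)) • jonesWenzl n := by
  induction n with
  | zero =>
    refine ⟨?_, ?_, partialTrace_jonesWenzl_one⟩
    · rw [jonesWenzl, idHom_comp]
    · rw [jonesWenzl, jonesWenzl, tensor_idHom, idHom_comp]
  | succ n ih =>
    obtain ⟨h1, h2, h3⟩ := ih
    refine ⟨?_, jonesWenzl_comp_tensor_of_idempotent n h1,
      partialTrace_jonesWenzl_of_idempotent n h1⟩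
    set P := tensor (jonesWenzl (n + 1)) (idHom 1) with hP
    set c := quantumInt (n + 1) / quantumInt (n + 2) with hc
    have hPP : comp P P = P := by rw [hP, ← tensor_comp, h1]
    -- Slide `p_n` above the cup, where `P` absorbs it by the induction hypothesis.
    have hcup : comp P (comp (cupRight n) (jonesWenzl n)) = comp P (cupRight n) := by
      rw [cupRight_comp, ← comp_assoc, hP, ← tensor_comp, h2]
    -- The left side is by definition the partial trace of `p_{n+1}`; its coefficient is inverse to
    -- the one in the recursion.
    have hcap : comp (capRight n) (comp P (cupRight n)) = c⁻¹ • jonesWenzl n := by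
      rw [hc, inv_div]; exact h3
    have habs := jonesWenzl_comp_tensor_of_idempotent n h1
    have hc0 : c ≠ 0 := div_ne_zero (quantumInt_ne_zero (by omega)) (quantumInt_ne_zero (by omega))
    -- The two terms of the recursion become `P ∘ cup` and `c c⁻¹ P ∘ cup`, which cancel.
    have hkill : comp (jonesWenzl (n + 2)) (cupRight n) = 0 := by
      rw [jonesWenzl_succ_succ, map_sub, map_smul, LinearMap.sub_apply, LinearMap.smul_apply,
        comp_assoc, comp_assoc, comp_assoc, hcap, map_smul, map_smul, hcup, smul_smul,
        mul_inv_cancel₀ hc0, one_smul, sub_self]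
    -- Only the right factor is expanded: the left one absorbs `P`, and then kills the cup in the
    -- correction term.
    nth_rw 2 [jonesWenzl_succ_succ]
    rw [map_sub, map_smul, ← comp_assoc (jonesWenzl (n + 2)) P, habs, ← comp_assoc, ← comp_assoc,
      hkill]
    simp

end TemperleyLieb

/-! ### The full trace from the partial traces -/

theorem mainTheorem2 :
    (∀ n : ℕ, TemperleyLieb.trace (TemperleyLieb.jonesWenzl n) =
      TemperleyLieb.quantumInt (n + 1)) ∧
    (∀ n : ℕ, TemperleyLieb.partialTrace (TemperleyLieb.jonesWenzl (n + 1)) =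
      (TemperleyLieb.quantumInt (n + 2) / TemperleyLieb.quantumInt (n + 1)) •
        TemperleyLieb.jonesWenzl n) := by
  have hpartial := fun n => (TemperleyLieb.jonesWenzl_properties n).2.2
  refine ⟨fun n => ?_, hpartial⟩
  induction n with
  | zero =>
    -- The empty diagram has no curves, so its trace is `d ^ 0 = 1 = [1]`.
    rw [TemperleyLieb.jonesWenzl, TemperleyLieb.idHom, TemperleyLieb.trace_ofDiagram,
      TemperleyLieb.Diagram.closureLoops, Nat.card_eq_zero.2 (Or.inl ?_), pow_zero,
      TemperleyLieb.quantumInt_one]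
    infer_instance
  | succ n ih =>
    -- Closing the last strand first makes the product telescope: `[n+2]/[n+1] · [n+1]`.
    rw [← TemperleyLieb.trace_partialTrace, hpartial, map_smul, ih, smul_eq_mul]
    exact div_mul_cancel₀ _ (TemperleyLieb.quantumInt_ne_zero (by omega))
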